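/- Let $\sigma$ be a countable relational signature. All $\sigma$-structures have nonempty universes. An \emph{abstract logic} over $\sigma$ consists of a collection of sentences together with an isomorphism-invariant satisfaction relation $\models$ between $\sigma$-structures and sentences; first-order logic $FO(\sigma)$, with its sentences and the usual satisfaction relation, is one. An abstract logic \emph{can express} an isomorphism-closed class $\mathbf{P}$ of $\sigma$-structures if it has a sentence whose models are exactly the members of $\mathbf{P}$. For abstract logics $L, L'$ over $\sigma$ write $L \geq L'$ if every isomorphism-closed class that can be expressed by $L'$ can be expressed by $L$, and write $L > L'$ if $L \geq L'$ and some isomorphism-closed class can be expressed by $L$ but not by $L'$. We say that $L$ has the \emph{$\aleph_0$-compactness property} if for every set $\Gamma$ of sentences of $L$ with $|\Gamma| \leq \aleph_0$ such that every finite $\Delta \subseteq \Gamma$ has a model, $\Gamma$ has a model. Theorem. Extend $FO(\sigma)$ with a new atomic sentence $P$: let $L(\sigma)$ be the least set of formulas that contains all atomic first-order formulas over $\sigma$ and $P$ and is closed under the first-order operations (Boolean connectives and quantification over elements). For every $\sigma$-structure $\mathcal{M}$, let $\mathcal{M} \models_{L(\sigma)} P$ if and only if $|\mathrm{Aut}(\mathcal{M})|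 \leq 2^{\aleph_0}$, where $\mathrm{Aut}(\mathcal{M})$ is the automorphism group of $\mathcal{M}$; otherwise $\models_{L(\sigma)}$ is defined just as for first-order formulas. Then $L(\sigma) > FO(\sigma)$, and $L(\sigma)$ has the $\aleph_0$-compactness property. -/

import Mathlib

universe u v w s s'

namespace AbstractLogics

open FirstOrder FirstOrder.Language Cardinal

/-- A `σ`-structure: a nonempty universe together with an interpretation of `σ`. -/
structure Str (σ : FirstOrder.Language.{u, v}) where
  /-- The universe of the structure. -/
  carrier : Type w
  [str : σ.Structure carrier]
  [nonempty : Nonempty carrier]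

attribute [instance] Str.str Str.nonempty

/-- Isomorphism of `σ`-structures. -/
def Str.Iso {σ : FirstOrder.Language.{u, v}} (M N : Str.{u, v, w} σ) : Prop :=
  Nonempty (M.carrier ≃[σ] N.carrier)

/-- A property of `σ`-structures: a class of `σ`-structures closed under isomorphism. -/
structure StrProperty (σ : FirstOrder.Language.{u, v}) where
  /-- The underlying class of structures. -/
  Holds : Str.{u, v, w} σ → Prop
  iso_closed : ∀ M N : Str.{u, v, w} σ, M.Iso N → Holds M → Holds N

/-- An abstract logic over `σ`: a collection of sentences with an isomorphism invariant
satisfaction relation between `σ`-structures and sentences. -/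
structure AbstractLogic (σ : FirstOrder.Language.{u, v}) where
  /-- The sentences of the logic. -/
  Sentence : Type s
  /-- The satisfaction relation. -/
  Sat : Str.{u, v, w} σ → Sentence → Prop
  iso_invariant : ∀ (φ : Sentence) (M N : Str.{u, v, w} σ), M.Iso N → Sat M φ → Sat N φ

namespace AbstractLogic

variable {σ : FirstOrder.Language.{u, v}}

/-- `M` satisfies every sentence in `Γ`. -/
def SatSet (L : AbstractLogic.{u, v, w, s} σ) (M : Str.{u, v, w} σ) (Γ : Set L.Sentence) : Prop :=
  ∀ φ ∈ Γ, L.Sat M φ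

/-- The property `P` can be expressed by the logic `L`. -/
def CanExpress (L : AbstractLogic.{u, v, w, s} σ) (P : StrProperty.{u, v, w} σ) : Prop :=
  ∃ φ : L.Sentence, ∀ M : Str.{u, v, w} σ, L.Sat M φ ↔ P.Holds M

/-- `L` is at least as strong as `L'`. -/
def AtLeastAsStrong (L : AbstractLogic.{u, v, w, s} σ) (L' : AbstractLogic.{u, v, w, s'} σ) :
    Prop :=
  ∀ P : StrProperty.{u, v, w} σ, L'.CanExpress P → L.CanExpress P

/-- `L` is (strictly) stronger than `L'`. -/
def Stronger (L : AbstractLogic.{u, v, w, s} σ) (L' : AbstractLogic.{u, v, w, s'} σ) : Prop :=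
  L.AtLeastAsStrong L' ∧ ∃ P : StrProperty.{u, v, w} σ, L.CanExpress P ∧ ¬ L'.CanExpress P

/-- The `κ`-compactness property. -/
def HasCompactnessProperty (L : AbstractLogic.{u, v, w, s} σ) (κ : Cardinal.{s}) : Prop :=
  ∀ Γ : Set L.Sentence, #Γ ≤ κ →
    (∀ Δ : Set L.Sentence, Δ ⊆ Γ → Δ.Finite → ∃ M : Str.{u, v, w} σ, L.SatSet M Δ) →
      ∃ M : Str.{u, v, w} σ, L.SatSet M Γ

end AbstractLogic

/-- First-order logic `FO(σ)` as an abstract logic. -/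
def FO (σ : FirstOrder.Language.{u, v}) : AbstractLogic.{u, v, w, max u v} σ where
  Sentence := σ.Sentence
  Sat M φ := M.carrier ⊨ φ
  iso_invariant φ M N h hM := by
    obtain ⟨e⟩ := h
    exact (StrongHomClass.realize_sentence e φ).1 hM

/-- The formulas built from the atomic first-order formulas over `σ` and one new atomic sentence
`P` by the first-order operations. As for `FirstOrder.Language.BoundedFormula`, the free variables
are indexed by `α` and by `Fin n`, the primitive operations are falsum, implication and universal
quantification, and `all` binds the last of the `Fin (n + 1)` variables. -/
inductive PFormula (σ : FirstOrder.Language.{u, v}) (α : Type) : ℕ → Type (max u v)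
  | falsum {n : ℕ} : PFormula σ α n
  | equal {n : ℕ} (t₁ t₂ : σ.Term (α ⊕ Fin n)) : PFormula σ α n
  | rel {n l : ℕ} (R : σ.Relations l) (ts : Fin l → σ.Term (α ⊕ Fin n)) : PFormula σ α n
  | P {n : ℕ} : PFormula σ α n
  | imp {n : ℕ} (φ ψ : PFormula σ α n) : PFormula σ α n
  | all {n : ℕ} (φ : PFormula σ α (n + 1)) : PFormula σ α n

/-- The automorphism group of `M` has cardinality at most `2 ^ ℵ₀`. -/
def FewAut (σ : FirstOrder.Language.{u, v}) (M : Type w) [σ.Structure M] : Prop :=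
  #(M ≃[σ] M) ≤ 2 ^ ℵ₀

/-- Satisfaction of formulas: `P` holds in `M` iff `|Aut(M)| ≤ 2 ^ ℵ₀`, everything else is as in
first-order logic. -/
def PFormula.Realize {σ : FirstOrder.Language.{u, v}} {α : Type} {M : Type w} [σ.Structure M] :
    ∀ {n : ℕ}, PFormula σ α n → (α → M) → (Fin n → M) → Prop
  | _, .falsum, _, _ => False
  | _, .equal t₁ t₂, x, xs => t₁.realize (Sum.elim x xs) = t₂.realize (Sum.elim x xs)
  | _, .rel R ts, x, xs => Structure.RelMap R fun i => (ts i).realize (Sum.elim x xs)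
  | _, .P, _, _ => FewAut σ M
  | _, .imp φ ψ, x, xs => φ.Realize x xs → ψ.Realize x xs
  | _, .all φ, x, xs => ∀ a : M, φ.Realize x (Fin.snoc xs a)

theorem FewAut.of_equiv {σ : FirstOrder.Language.{u, v}} {M N : Type w} [σ.Structure M] [σ.Structure N]
    (e : M ≃[σ] N) (h : FewAut σ M) : FewAut σ N := by
  refine le_trans (Cardinal.mk_le_of_injective
    (f := fun g : N ≃[σ] N => e.symm.comp (g.comp e)) ?_) h
  intro g g' hg
  ext x
  have := congrArg (fun k : M ≃[σ] M => e (k (e.symm x))) hg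
  simpa using this

theorem PFormula.realize_equiv {σ : FirstOrder.Language.{u, v}} {α : Type} {M N : Type w} [σ.Structure M]
    [σ.Structure N] (e : M ≃[σ] N) {n : ℕ} (φ : PFormula σ α n) (x : α → M) (xs : Fin n → M) :
    φ.Realize (e ∘ x) (e ∘ xs) ↔ φ.Realize x xs := by
  induction φ with
  | falsum => exact Iff.rfl
  | equal t₁ t₂ =>
    simp only [Realize, ← Sum.comp_elim, HomClass.realize_term, EmbeddingLike.apply_eq_iff_eq]
  | rel R ts =>
    simp only [Realize, ← Sum.comp_elim, HomClass.realize_term]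
    exact StrongHomClass.map_rel e R _
  | P => exact ⟨FewAut.of_equiv e.symm, FewAut.of_equiv e⟩
  | imp φ ψ ih₁ ih₂ => simp only [Realize, ih₁, ih₂]
  | all φ ih =>
    simp only [Realize]
    constructor
    · intro h a
      rw [← ih, Fin.comp_snoc]
      exact h (e a)
    · intro h b
      have := (ih (Fin.snoc xs (e.symm b))).2 (h _)
      rwa [Fin.comp_snoc, e.apply_symm_apply] at this

/-- The logic `L(σ)` obtained from `FO(σ)` by adding the atomic sentence `P`. Its sentences are the
formulas without free variables. -/
def FOWithP (σ : FirstOrder.Language.{u, v}) : AbstractLogic.{u, v, w, max u v} σ where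
  Sentence := PFormula σ Empty 0
  Sat M φ := φ.Realize (Empty.elim : Empty → M.carrier) Fin.elim0
  iso_invariant φ M N h hM := by
    obtain ⟨e⟩ := h
    have := (φ.realize_equiv e Empty.elim Fin.elim0).2 hM
    convert this using 1

end AbstractLogics

/-! On structures with few automorphisms `P` agrees with `⊤`, on all others with `⊥`, so on each of
the two classes every sentence is equivalent to a first-order one (`PFormula.realize_substP`).

Compactness: if all finite parts of `Γ` have models with few automorphisms, first-order compactness
and Löwenheim–Skolem give a countable model of `Γ` with `⊤` for `P`, and countable structures have
few automorphisms (`exists_fewAut_model`). Otherwise some finite `Δ₀ ⊆ Γ` forces many automorphisms.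
Then every finite part of `Γ` with `⊥` for `P` has a model with many, and naming `(2 ^ ℵ₀)⁺` of them
by new function symbols reduces the claim to first-order compactness (`exists_not_fewAut_model`).

Strictness: `P` separates an uncountable structure without relations from a countable elementary
substructure. -/

namespace AbstractLogics

open FirstOrder FirstOrder.Language Cardinal

/-! ### Eliminating `P` in favour of `⊤` or `⊥` -/

section Translation

variable {σ : FirstOrder.Language.{u, v}} {α : Type}

/-- The `PFormula` with the same shape as a first-order formula. -/
def PFormula.ofBoundedFormula : ∀ {n : ℕ}, σ.BoundedFormula α n → PFormula σ α n
  | _, .falsum => .falsum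
  | _, .equal t₁ t₂ => .equal t₁ t₂
  | _, .rel R ts => .rel R ts
  | _, .imp φ ψ => .imp (ofBoundedFormula φ) (ofBoundedFormula ψ)
  | _, .all φ => .all (ofBoundedFormula φ)

theorem PFormula.realize_ofBoundedFormula {M : Type w} [σ.Structure M] {n : ℕ}
    (φ : σ.BoundedFormula α n) (x : α → M) (xs : Fin n → M) :
    (ofBoundedFormula φ).Realize x xs ↔ φ.Realize x xs := by
  induction φ with
  | falsum => exact Iff.rfl
  | equal t₁ t₂ => exact Iff.rfl
  | rel R ts => exact Iff.rfl
  | imp φ ψ ih₁ ih₂ => exact imp_congr (ih₁ xs) (ih₂ xs)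
  | all φ ih => exact forall_congr' fun a => ih _

/-- The first-order formula obtained by replacing `P` with the sentence `π`. -/
def PFormula.substP (π : ∀ n, σ.BoundedFormula α n) :
    ∀ {n : ℕ}, PFormula σ α n → σ.BoundedFormula α n
  | _, .falsum => .falsum
  | _, .equal t₁ t₂ => .equal t₁ t₂
  | _, .rel R ts => .rel R ts
  | n, .P => π n
  | _, .imp φ ψ => .imp (φ.substP π) (ψ.substP π)
  | _, .all φ => .all (φ.substP π)

/-- The induction passes through quantifiers because the truth of `P` depends on the structure
alone, not on the assignment. -/
theorem PFormula.realize_substP {M : Type w} [σ.Structure M] (π : ∀ n, σ.BoundedFormula α n)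
    (hπ : ∀ n (x : α → M) (xs : Fin n → M), (π n).Realize x xs ↔ FewAut σ M) {n : ℕ}
    (φ : PFormula σ α n) (x : α → M) (xs : Fin n → M) :
    (φ.substP π).Realize x xs ↔ φ.Realize x xs := by
  induction φ with
  | falsum => exact Iff.rfl
  | equal t₁ t₂ => exact Iff.rfl
  | rel R ts => exact Iff.rfl
  | P => exact hπ _ x xs
  | imp φ ψ ih₁ ih₂ => exact imp_congr (ih₁ xs) (ih₂ xs)
  | all φ ih => exact forall_congr' fun a => ih _

theorem sat_iff_substP_top {M : Str.{u, v, w} σ} (hM : FewAut σ M.carrier)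
    (φ : (FOWithP.{u, v, w} σ).Sentence) :
    (FOWithP σ).Sat M φ ↔ M.carrier ⊨ (PFormula.substP (fun _ => ⊤) φ : σ.Sentence) := by
  refine (PFormula.realize_substP (fun _ => ⊤) (fun n x xs => ?_) φ _ _).symm.trans ?_
  · simpa using hM
  · exact iff_of_eq (congrArg₂ _ (Subsingleton.elim _ _) (Subsingleton.elim _ _))

theorem sat_iff_substP_bot {M : Str.{u, v, w} σ} (hM : ¬ FewAut σ M.carrier)
    (φ : (FOWithP.{u, v, w} σ).Sentence) :
    (FOWithP σ).Sat M φ ↔ M.carrier ⊨ (PFormula.substP (fun _ => ⊥) φ : σ.Sentence) := by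
  refine (PFormula.realize_substP (fun _ => ⊥) (fun n x xs => ?_) φ _ _).symm.trans ?_
  · simpa using hM
  · exact iff_of_eq (congrArg₂ _ (Subsingleton.elim _ _) (Subsingleton.elim _ _))

end Translation

/-! ### Counting automorphisms of countable structures -/

section Automorphisms

variable {σ : FirstOrder.Language.{u, v}}

theorem fewAut_of_countable (M : Type w) [σ.Structure M] [Countable M] : FewAut σ M := by
  refine (mk_le_of_injective (f := fun g : M ≃[σ] M => (g : M → M)) DFunLike.coe_injective).trans ?_
  rw [← power_def]
  calc #M ^ #M ≤ ℵ₀ ^ ℵ₀ :=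
        (power_le_power_right (mk_le_aleph0 (α := M))).trans
          (power_le_power_left aleph0_ne_zero mk_le_aleph0)
    _ = 2 ^ ℵ₀ := power_self_eq le_rfl

theorem infinite_of_not_fewAut {M : Type w} [σ.Structure M] (hM : ¬ FewAut σ M) : Infinite M := by
  by_contra h
  rw [not_infinite_iff_finite] at h
  exact hM (fewAut_of_countable M)

end Automorphisms

theorem card_le_aleph0 (σ : FirstOrder.Language.{u, v}) [σ.IsRelational]
    [Countable (Σ n, σ.Relations n)] : σ.card ≤ ℵ₀ := by
  have : IsEmpty (Σ n, σ.Functions n) := ⟨fun x => isEmptyElim x.2⟩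
  exact mk_le_aleph0 (α := σ.Symbols)

/-! ### `P` is not first-order expressible -/

section Strictness

/-- The reals, lifted to an arbitrary universe, as a structure in which no relation holds. -/
structure TrivialReal : Type w where
  /-- The underlying lifted real. -/
  toULift : ULift.{w} ℝ

/-- `TrivialReal` is in bijection with the reals. -/
def TrivialReal.equivReal : TrivialReal.{w} ≃ ℝ :=
  ⟨fun x => x.toULift.down, fun r => ⟨⟨r⟩⟩, fun _ => rfl, fun _ => rfl⟩

variable (σ : FirstOrder.Language.{u, v}) [σ.IsRelational]

instance TrivialReal.instStructure : σ.Structure TrivialReal.{w} where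
  funMap f := isEmptyElim f
  RelMap _ _ := False

instance : Nonempty TrivialReal.{w} := ⟨⟨⟨0⟩⟩⟩

theorem not_fewAut_trivialReal : ¬ FewAut σ TrivialReal.{w} := by
  have hinj : Function.Injective (fun g : Equiv.Perm TrivialReal.{w} =>
      (⟨g, fun f => isEmptyElim f, fun _ _ => Iff.rfl⟩ : TrivialReal.{w} ≃[σ] TrivialReal.{w})) :=
    fun g g' h => congrArg (fun k : TrivialReal.{w} ≃[σ] TrivialReal.{w} => k.toEquiv) h
  have hcard : #TrivialReal.{w} = 2 ^ ℵ₀ := by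
    have := lift_mk_eq'.2 ⟨TrivialReal.equivReal.{w}⟩
    rw [mk_real] at this
    simpa using this
  -- With no relation holding, every permutation is an automorphism; an infinite set of size `2 ^
  -- ℵ₀` has `2 ^ 2 ^ ℵ₀` of them.
  have : Infinite TrivialReal.{w} := Infinite.of_injective _ TrivialReal.equivReal.{w}.symm.injective
  refine not_le.2 (lt_of_lt_of_le ?_ (mk_le_of_injective hinj))
  rw [mk_perm_eq_two_power, hcard]
  exact cantor _

/-- The class of structures with at most `2 ^ ℵ₀` automorphisms. -/
def fewAutProperty : StrProperty.{u, v, w} σ where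
  Holds M := FewAut σ M.carrier
  iso_closed _ _ := fun ⟨e⟩ => FewAut.of_equiv e

/-- A first-order sentence cannot tell `TrivialReal` from a countable elementary substructure, but
`FewAut` can. -/
theorem not_canExpress_fewAutProperty [Countable (Σ n, σ.Relations n)] :
    ¬ (FO.{u, v, w} σ).CanExpress (fewAutProperty.{u, v, w} σ) := by
  rintro ⟨φ, hφ⟩
  have : Infinite TrivialReal.{w} := infinite_of_not_fewAut (not_fewAut_trivialReal σ)
  obtain ⟨S, -, hS⟩ := exists_elementarySubstructure_card_eq σ (∅ : Set TrivialReal.{w})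
    (ℵ₀ : Cardinal.{w}) le_rfl (by simp) (by simpa using card_le_aleph0 σ) (by simp)
  have : Countable S := by
    rw [← mk_le_aleph0_iff]
    simpa using hS.le
  have h₁ := (hφ ⟨S⟩).2 (fewAut_of_countable S)
  exact not_fewAut_trivialReal σ ((hφ ⟨TrivialReal.{w}⟩).1 ((S.realize_sentence φ).1 h₁))

theorem stronger_FO [Countable (Σ n, σ.Relations n)] :
    (FOWithP.{u, v, w} σ).Stronger (FO.{u, v, w} σ) := by
  refine ⟨?_, fewAutProperty σ, ⟨.P, fun M => Iff.rfl⟩, not_canExpress_fewAutProperty σ⟩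
  rintro Q ⟨φ, hφ⟩
  refine ⟨.ofBoundedFormula φ, fun M => Iff.trans ?_ (hφ M)⟩
  refine (PFormula.realize_ofBoundedFormula φ _ _).trans ?_
  exact iff_of_eq (congrArg₂ _ (Subsingleton.elim _ _) (Subsingleton.elim _ _))

end Strictness

/-! ### Axiomatizing a family of distinct automorphisms -/

section NamedAutomorphisms

/-- The function symbols of a language with one unary function symbol for each `i : I`. -/
inductive UnarySymbol (I : Type w) : ℕ → Type w
  | symb (i : I) : UnarySymbol I 1

/-- The language with one unary function symbol for each `i : I` and no relations. -/
def unaryLanguage (I : Type w) : FirstOrder.Language.{w, 0} :=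
  ⟨UnarySymbol I, fun _ => Empty⟩

theorem card_unaryLanguage (I : Type w) : (unaryLanguage I).card = #I := by
  have e : (Σ n, (unaryLanguage I).Functions n) ≃ I :=
    { toFun := fun ⟨_, .symb i⟩ => i
      invFun := fun i => ⟨1, .symb i⟩
      left_inv := fun ⟨_, .symb i⟩ => rfl
      right_inv := fun _ => rfl }
  have : IsEmpty (Σ n, (unaryLanguage I).Relations n) := ⟨fun x => Empty.elim x.2⟩
  rw [card, Symbols, mk_sum, mk_eq_zero (Σ n, (unaryLanguage I).Relations n), e.cardinal_eq]
  simp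

variable (σ : FirstOrder.Language.{u, v}) {I : Type w}

variable (I) in
/-- The inclusion of `σ` into its expansion by unary function symbols. -/
abbrev namingLHom : σ →ᴸ σ.sum (unaryLanguage I) := LHom.sumInl

/-- The unary function symbol named by `i` in the expanded language. -/
def nameSymb (i : I) : (σ.sum (unaryLanguage I)).Functions 1 := .inr (.symb i)

/-- `i` names an injective function. -/
def injectiveSentence (i : I) : (σ.sum (unaryLanguage I)).Sentence :=
  ∀' ∀' (((nameSymb σ i).apply₁ (&0) =' (nameSymb σ i).apply₁ (&1)) ⟹ (&0 =' &1))

/-- `i` names a surjective function. -/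
def surjectiveSentence (i : I) : (σ.sum (unaryLanguage I)).Sentence :=
  ∀' ∃' ((nameSymb σ i).apply₁ (&1) =' &0)

/-- `i` and `j` name distinct functions. -/
def distinctSentence (i j : I) : (σ.sum (unaryLanguage I)).Sentence :=
  ∃' ∼((nameSymb σ i).apply₁ (&0) =' (nameSymb σ j).apply₁ (&0))

/-- The function named by `i` preserves `R` in both directions. -/
noncomputable def relationSentence (i : I) {l : ℕ} (R : σ.Relations l) :
    (σ.sum (unaryLanguage I)).Sentence :=
  Formula.iAlls (Fin l)
    (Formula.iff
      (Relations.formula ((namingLHom σ I).onRelation R)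
        fun k => (nameSymb σ i).apply₁ (Term.var (Sum.inr k)))
      (Relations.formula ((namingLHom σ I).onRelation R)
        fun k => Term.var (Sum.inr k)))

/-- The theory saying that the elements of `I` name pairwise distinct automorphisms of the
`σ`-reduct, for a relational language `σ`. -/
def automorphismTheory (I : Type w) : (σ.sum (unaryLanguage I)).Theory :=
  {φ | (∃ i : I, φ = injectiveSentence σ i) ∨ (∃ i : I, φ = surjectiveSentence σ i) ∨
    (∃ i j : I, i ≠ j ∧ φ = distinctSentence σ i j) ∨
    ∃ (i : I) (l : ℕ) (R : σ.Relations l), φ = relationSentence σ i R}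

section Semantics

variable {σ} {M : Type s} [(σ.sum (unaryLanguage I)).Structure M]

/-- The interpretation of the symbol named by `i`. -/
def namedFun (σ : FirstOrder.Language.{u, v}) (M : Type s)
    [(σ.sum (unaryLanguage I)).Structure M] (i : I) (a : M) : M :=
  Structure.funMap (nameSymb σ i) ![a]

theorem realize_injectiveSentence (i : I) :
    M ⊨ injectiveSentence σ i ↔ Function.Injective (namedFun σ M i) := by
  simp [injectiveSentence, Sentence.Realize, Formula.Realize, Function.Injective, namedFun,
    Fin.snoc]

theorem realize_surjectiveSentence (i : I) :
    M ⊨ surjectiveSentence σ i ↔ Function.Surjective (namedFun σ M i) := by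
  simp [surjectiveSentence, Sentence.Realize, Formula.Realize, Function.Surjective, namedFun,
    Fin.snoc]

theorem realize_distinctSentence (i j : I) :
    M ⊨ distinctSentence σ i j ↔ namedFun σ M i ≠ namedFun σ M j := by
  simp [distinctSentence, Sentence.Realize, Formula.Realize, Function.ne_iff, namedFun, Fin.snoc]

theorem realize_relationSentence (i : I) {l : ℕ} (R : σ.Relations l) :
    M ⊨ relationSentence σ i R ↔ ∀ x : Fin l → M,
      (Structure.RelMap ((namingLHom σ I).onRelation R) (fun k => namedFun σ M i (x k)) ↔
        Structure.RelMap ((namingLHom σ I).onRelation R) x) := by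
  simp only [relationSentence, Sentence.Realize, Formula.realize_iAlls, Formula.realize_iff,
    Formula.realize_rel, Term.realize_functions_apply₁, Term.realize_var, Sum.elim_inr]
  rfl

theorem model_automorphismTheory_iff :
    M ⊨ automorphismTheory σ I ↔
      (∀ i : I, Function.Bijective (namedFun σ M i)) ∧ Function.Injective (namedFun (I := I) σ M) ∧
        ∀ (i : I) (l : ℕ) (R : σ.Relations l) (x : Fin l → M),
          (Structure.RelMap ((namingLHom σ I).onRelation R) (fun k => namedFun σ M i (x k)) ↔
            Structure.RelMap ((namingLHom σ I).onRelation R) x) := by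
  rw [Theory.model_iff]
  constructor
  · intro h
    refine ⟨fun i => ⟨(realize_injectiveSentence i).1 (h _ (.inl ⟨i, rfl⟩)),
      (realize_surjectiveSentence i).1 (h _ (.inr (.inl ⟨i, rfl⟩)))⟩, fun i j hij => ?_,
      fun i l R => (realize_relationSentence i R).1 (h _ (.inr (.inr (.inr ⟨i, l, R, rfl⟩))))⟩
    by_contra hne
    exact (realize_distinctSentence i j).1 (h _ (.inr (.inr (.inl ⟨i, j, hne, rfl⟩)))) hij
  · rintro ⟨hbij, hinj, hrel⟩ φ (⟨i, rfl⟩ | ⟨i, rfl⟩ | ⟨i, j, hne, rfl⟩ | ⟨i, l, R, rfl⟩)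
    · exact (realize_injectiveSentence i).2 (hbij i).1
    · exact (realize_surjectiveSentence i).2 (hbij i).2
    · exact (realize_distinctSentence i j).2 (hinj.ne hne)
    · exact (realize_relationSentence i R).2 (hrel i l R)

end Semantics

variable {σ}

/-- Automorphisms of `M` indexed by `I` interpret the unary symbols. -/
@[reducible]
def unaryStructure {M : Type s} [σ.Structure M] (g : I → (M ≃[σ] M)) :
    (unaryLanguage I).Structure M where
  funMap := fun {_} f x => match f, x with
    | .symb i, x => g i (x 0)
  RelMap := fun {_} R => Empty.elim R

/-- A theory is consistent with the existence of `I`-many automorphisms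
if each finite part of it has a model with `I`-many automorphisms. -/
theorem isSatisfiable_union_automorphismTheory (T : σ.Theory)
    (h : ∀ T₀ : Set σ.Sentence, T₀ ⊆ T → T₀.Finite → ∃ M : Str.{u, v, s} σ,
      M.carrier ⊨ (T₀ : σ.Theory) ∧ Nonempty (I ↪ (M.carrier ≃[σ] M.carrier))) :
    ((namingLHom σ I).onTheory T ∪
      automorphismTheory σ I).IsSatisfiable := by
  rw [Theory.isSatisfiable_iff_isFinitelySatisfiable]
  intro F hF
  let ι := namingLHom σ I
  -- Only the part of `F` coming from `T` has to be finite: the model chosen below satisfies all of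
  -- `automorphismTheory σ I`.
  obtain ⟨T₀, hT₀, hfin, hFT⟩ : ∃ T₀ ⊆ T, T₀.Finite ∧
      (F : Set _) ∩ ι.onTheory T ⊆ ι.onTheory T₀ := by
    obtain ⟨T₀, hsub, hfin, heq⟩ := (F.finite_toSet.subset
      Set.inter_subset_left).exists_subset_finite_image_eq
        (Set.inter_subset_right : (F : Set _) ∩ ι.onTheory T ⊆ ι.onSentence '' T)
    exact ⟨T₀, hsub, hfin, heq.ge⟩
  obtain ⟨M, hM, ⟨g⟩⟩ := h T₀ hT₀ hfin
  let := unaryStructure g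
  have h₁ : M.carrier ⊨ ι.onTheory T₀ := (LHom.onTheory_model ι T₀).2 hM
  have hg : ∀ i, namedFun σ M.carrier i = g i := fun i => rfl
  have h₂ : M.carrier ⊨ automorphismTheory σ I := by
    rw [model_automorphismTheory_iff]
    refine ⟨fun i => (g i).bijective, fun i j hij => g.injective (DFunLike.coe_injective hij),
      fun i l R x => ?_⟩
    rw [LHom.map_onRelation, LHom.map_onRelation]
    exact (g i).map_rel R x
  have : M.carrier ⊨ ((F : Set _) : (σ.sum (unaryLanguage I)).Theory) := by
    refine (Theory.model_iff _).2 fun φ hφ => ?_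
    rcases hF hφ with hφT | hφA
    · exact Theory.realize_sentence_of_mem _ (hFT ⟨hφ, hφT⟩)
    · exact Theory.realize_sentence_of_mem _ hφA
  exact Theory.Model.isSatisfiable M.carrier

/-- In a relational language, a model of `automorphismTheory σ I` has `I`-many automorphisms. -/
theorem nonempty_embedding_of_model [σ.IsRelational] {M : Type s} [σ.Structure M]
    [(σ.sum (unaryLanguage I)).Structure M]
    [(namingLHom σ I).IsExpansionOn M]
    (hM : M ⊨ automorphismTheory σ I) : Nonempty (I ↪ (M ≃[σ] M)) := by
  obtain ⟨hbij, hinj, hrel⟩ := model_automorphismTheory_iff.1 hM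
  -- There are no function symbols in `σ`, so preserving relations in both directions suffices.
  refine ⟨⟨fun i => ⟨Equiv.ofBijective _ (hbij i), fun f => isEmptyElim f, fun {l} R x => ?_⟩,
    fun i j hij => hinj ?_⟩⟩
  · have := hrel i l R x
    rwa [LHom.map_onRelation, LHom.map_onRelation] at this
  · exact congrArg (fun k : M ≃[σ] M => (k : M → M)) hij

end NamedAutomorphisms

/-! ### Compactness with few and with many automorphisms -/

section Compactness

variable {σ : FirstOrder.Language.{u, v}} [σ.IsRelational] [Countable (Σ n, σ.Relations n)]

/-- A finitely satisfiable theory in a countable relational language has a model with few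
automorphisms. -/
theorem exists_fewAut_model (T : σ.Theory)
    (h : ∀ T₀ : Set σ.Sentence, T₀ ⊆ T → T₀.Finite → ∃ M : Str.{u, v, w} σ,
      M.carrier ⊨ (T₀ : σ.Theory)) :
    ∃ M : Str.{u, v, w} σ, M.carrier ⊨ T ∧ FewAut σ M.carrier := by
  have hT : T.IsSatisfiable := by
    rw [Theory.isSatisfiable_iff_isFinitelySatisfiable]
    intro F hF
    obtain ⟨M, hM⟩ := h F hF F.finite_toSet
    exact Theory.Model.isSatisfiable M.carrier
  obtain ⟨M⟩ := hT
  rcases finite_or_infinite M with hfin | hinf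
  -- A finite model is already countable; it only has to be moved to universe `w`.
  · let N : Theory.ModelType.{u, v, w} T := Theory.ModelType.shrink.{u, v, max u v, w} M
    have : Finite N := Finite.of_equiv M (equivShrink.{w} M)
    exact ⟨⟨N⟩, N.is_model, fewAut_of_countable N⟩
  · obtain ⟨N, hN⟩ := Theory.exists_model_card_eq ⟨M, hinf⟩ (ℵ₀ : Cardinal.{w}) le_rfl
      (by simpa using card_le_aleph0 σ)
    have : Countable N := mk_le_aleph0_iff.1 hN.le
    exact ⟨⟨N⟩, N.is_model, fewAut_of_countable N⟩

/-- A theory in a countable relational language each of whose finite parts has a model with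
more than `2 ^ ℵ₀` automorphisms has a model with more than `2 ^ ℵ₀` automorphisms. -/
theorem exists_not_fewAut_model (T : σ.Theory)
    (h : ∀ T₀ : Set σ.Sentence, T₀ ⊆ T → T₀.Finite → ∃ M : Str.{u, v, w} σ,
      M.carrier ⊨ (T₀ : σ.Theory) ∧ ¬ FewAut σ M.carrier) :
    ∃ M : Str.{u, v, w} σ, M.carrier ⊨ T ∧ ¬ FewAut σ M.carrier := by
  obtain ⟨I, hI⟩ : ∃ I : Type w, #I = Order.succ (2 ^ ℵ₀) := ⟨_, mk_out _⟩
  have hI₀ : ℵ₀ ≤ #I := hI ▸ (cantor ℵ₀).le.trans (Order.le_succ _)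
  have few_iff : ∀ (M : Type w) [σ.Structure M],
      ¬ FewAut σ M ↔ Nonempty (I ↪ (M ≃[σ] M)) := fun M _ => by
    rw [FewAut, not_le, ← Order.succ_le_iff, ← hI, le_def]
  have hsat := isSatisfiable_union_automorphismTheory (I := I) T fun T₀ hT₀ hfin => by
    obtain ⟨M, hM, hfew⟩ := h T₀ hT₀ hfin
    exact ⟨M, hM, (few_iff _).1 hfew⟩
  obtain ⟨M⟩ := hsat
  have hinf : Infinite M := by
    have hM : M ⊨ automorphismTheory σ I := Theory.Model.mono M.is_model Set.subset_union_right
    have : Infinite I := infinite_iff.2 hI₀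
    by_contra hfin
    rw [not_infinite_iff_finite] at hfin
    -- Distinct indices name distinct self-maps, of which a finite `M` has only finitely many.
    have := Finite.of_injective _ (model_automorphismTheory_iff.1 hM).2.1
    exact not_finite I
  -- Löwenheim–Skolem serves to return to universe `w`; `#I` is large enough for the expanded
  -- language.
  obtain ⟨N, -⟩ := Theory.exists_model_card_eq ⟨M, hinf⟩ #I hI₀ (by
    rw [card_sum, card_unaryLanguage]
    simp only [lift_add, lift_lift]
    refine add_le_of_le (by simpa using hI₀) ?_ ?_
    · exact (lift_le.2 (card_le_aleph0 σ)).trans (by simpa using hI₀)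
    · simp)
  let : σ.Structure N := (namingLHom σ I).reduct N
  have : (namingLHom σ I).IsExpansionOn N :=
    LHom.isExpansionOn_reduct _ _
  have hN₁ : N ⊨ (namingLHom σ I).onTheory T :=
    Theory.Model.mono N.is_model Set.subset_union_left
  have hN₂ : N ⊨ automorphismTheory σ I := Theory.Model.mono N.is_model Set.subset_union_right
  exact ⟨⟨N⟩, (LHom.onTheory_model _ _).1 hN₁, (few_iff N).2 (nonempty_embedding_of_model hN₂)⟩

theorem hasCompactnessProperty_FOWithP :
    (FOWithP.{u, v, w} σ).HasCompactnessProperty ℵ₀ := by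
  intro Γ _ hΓ
  let top : (FOWithP.{u, v, w} σ).Sentence → σ.Sentence := PFormula.substP fun _ => ⊤
  let bot : (FOWithP.{u, v, w} σ).Sentence → σ.Sentence := PFormula.substP fun _ => ⊥
  by_cases hfew : ∀ Δ ⊆ Γ, Δ.Finite →
      ∃ M : Str.{u, v, w} σ, (FOWithP σ).SatSet M Δ ∧ FewAut σ M.carrier
  · obtain ⟨M, hM, hM'⟩ := exists_fewAut_model.{u, v, w} (top '' Γ) fun T₀ hT₀ hfin => by
      obtain ⟨Δ, hΔ, hΔfin, rfl⟩ := hfin.exists_subset_finite_image_eq hT₀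
      obtain ⟨M, hM, hM'⟩ := hfew Δ hΔ hΔfin
      refine ⟨M, (Theory.model_iff _).2 ?_⟩
      rintro _ ⟨φ, hφ, rfl⟩
      exact (sat_iff_substP_top hM' φ).1 (hM φ hφ)
    exact ⟨M, fun φ hφ => (sat_iff_substP_top hM' φ).2
      ((Theory.model_iff _).1 hM _ (Set.mem_image_of_mem _ hφ))⟩
  · push Not at hfew
    obtain ⟨Δ₀, hΔ₀, hΔ₀fin, hmany⟩ := hfew
    obtain ⟨M, hM, hM'⟩ := exists_not_fewAut_model.{u, v, w} (bot '' Γ) fun T₀ hT₀ hfin => by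
      obtain ⟨Δ, hΔ, hΔfin, rfl⟩ := hfin.exists_subset_finite_image_eq hT₀
      -- Adjoining `Δ₀` rules out models with few automorphisms.
      obtain ⟨M, hM⟩ := hΓ (Δ ∪ Δ₀) (Set.union_subset hΔ hΔ₀) (hΔfin.union hΔ₀fin)
      have hM' := hmany M fun φ hφ => hM φ (.inr hφ)
      refine ⟨M, (Theory.model_iff _).2 ?_, hM'⟩
      rintro _ ⟨φ, hφ, rfl⟩
      exact (sat_iff_substP_bot hM' φ).1 (hM φ (.inl hφ))
    exact ⟨M, fun φ hφ => (sat_iff_substP_bot hM' φ).2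
      ((Theory.model_iff _).1 hM _ (Set.mem_image_of_mem _ hφ))⟩

end Compactness

end AbstractLogics

theorem mainTheorem3 (σ : FirstOrder.Language.{u, v}) [σ.IsRelational]
    [Countable (Σ n, σ.Relations n)] :
    (AbstractLogics.FOWithP.{u, v, w} σ).Stronger (AbstractLogics.FO.{u, v, w} σ) ∧
      (AbstractLogics.FOWithP.{u, v, w} σ).HasCompactnessProperty Cardinal.aleph0 :=
  ⟨AbstractLogics.stronger_FO σ, AbstractLogics.hasCompactnessProperty_FOWithP⟩
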